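/- Let $K\neq\mathbb{Q}$ be a number field with algebraic closure $\bar K$, let $G_L=\mathrm{Gal}(\bar K/L)$ for $K\subseteq L\subseteq\bar K$, and let $K^{cyc}\subseteq\bar K$ be the field obtained from $K$ by adjoining all roots of unity. For an elliptic curve $(E,O)$ over $K$, let $E[\infty]\subseteq E(\bar K)$ be the set of all torsion points, $E^{*}[n]$ the set of torsion points of exact order $n$, and $\rho_{E}:G_{K}\to\mathrm{Aut}(E[\infty])\cong\mathrm{GL}(2,\hat{\mathbb{Z}})$ the adelic Galois representation (the condition on its image below does not depend on the chosen identification, since $\mathrm{SL}(2,\hat{\mathbb{Z}})$ is normal). For $i=1,2$, let $(E_{i},O_{i})$ be an elliptic curve over $K$ and let $\pi_{i}\in K(E_{i})$ be a rational function of degree $2$ that is even, i.e. $\pi_i(-P)=\pi_i(P)$, regarded as a morphism $\pi_i:E_i\to\mathbb{P}^1$ over $K$. Suppose that (A) $\pi_{1}(O_{1})=\pi_{2}(O_{2})$; (B) $\pi_{1}(E_{1}^{*}[n])\neq\pi_{2}(E_{2}^{*}[n])$ for every $n>1$; (C) $\rho_{E_{1}}(G_{K^{cyc}})=\rho_{E_{2}}(G_{K^{cyc}})=\mathrm{SL}(2,\hat{\mathbb{Z}})$.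 Then $\pi_{1}(E_{1}[\infty])\cap\pi_{2}(E_{2}[\infty])$, as a subset of $\mathbb{P}^1(\bar K)$, consists of exactly one point: $$\#\,\pi_{1}(E_{1}[\infty])\cap\pi_{2}(E_{2}[\infty])=1.$$ -/

import Mathlib

noncomputable section

open scoped Classical

namespace ProjTorsion

open WeierstrassCurve

/-! ### The ring of profinite integers -/

/-- The ring `Ẑ = lim ℤ/n` of profinite integers, as the subring of compatible families of
`∏ₙ ℤ/n`. -/
def ZHat : Subring (∀ n : ℕ+, ZMod n) where
  carrier := {x | ∀ (m n : ℕ+) (h : (m : ℕ) ∣ n), ZMod.castHom h (ZMod m) (x n) = x m}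
  mul_mem' := fun ha hb m n h => by
    rw [Pi.mul_apply, Pi.mul_apply, map_mul, ha m n h, hb m n h]
  one_mem' := fun m n h => by rw [Pi.one_apply, Pi.one_apply, map_one]
  add_mem' := fun ha hb m n h => by
    rw [Pi.add_apply, Pi.add_apply, map_add, ha m n h, hb m n h]
  zero_mem' := fun m n h => by rw [Pi.zero_apply, Pi.zero_apply, map_zero]
  neg_mem' := fun ha m n h => by rw [Pi.neg_apply, Pi.neg_apply, map_neg, ha m n h]

variable {K : Type*} [Field K]

/-! ### Geometric points, torsion and the Galois action -/

/-- The group `E(K̄)` of points over the algebraic closure. -/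
abbrev GeomPoint (E : WeierstrassCurve K) : Type _ :=
  Affine.Point (E.toAffine.baseChange (AlgebraicClosure K))

/-- The action of `σ ∈ Gal(K̄/K)` on `E(K̄)`, coordinate by coordinate. -/
def galPoint (E : WeierstrassCurve K) (σ : AlgebraicClosure K ≃ₐ[K] AlgebraicClosure K) :
    GeomPoint E →+ GeomPoint E :=
  Affine.Point.map (W' := E.toAffine) (σ : AlgebraicClosure K →ₐ[K] AlgebraicClosure K)

/-- The set `E[∞]` of all torsion points. -/
def torsionPoints (E : WeierstrassCurve K) : Set (GeomPoint E) := {P | IsOfFinAddOrder P}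

/-- The set `E*[n]` of torsion points of exact order `n`. -/
def exactTorsion (E : WeierstrassCurve K) (n : ℕ) : Set (GeomPoint E) := {P | addOrderOf P = n}

/-- The subgroup `E[n]`. -/
abbrev nTorsion (E : WeierstrassCurve K) (n : ℕ+) : AddSubgroup (GeomPoint E) :=
  AddSubgroup.torsionBy (GeomPoint E) ((n : ℕ) : ℤ)

instance nTorsionModule (E : WeierstrassCurve K) (n : ℕ+) : Module (ZMod n) (nTorsion E n) :=
  AddSubgroup.torsionBy.zmodModule

/-- The action of `Gal(K̄/K)` on the `ℤ/n`-module `E[n]`. -/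
def galTorsion (E : WeierstrassCurve K) (n : ℕ+) :
    (AlgebraicClosure K ≃ₐ[K] AlgebraicClosure K) →* Module.End (ZMod n) (nTorsion E n) where
  toFun σ := AddMonoidHom.toZModLinearMap n
    (((galPoint E σ).comp (nTorsion E n).subtype).codRestrict (nTorsion E n) fun P => by
      have hP : (n : ℕ) • (P : GeomPoint E) = 0 := AddSubgroup.torsionBy.nsmul_iff.mp P.2
      refine AddSubgroup.torsionBy.nsmul_iff.mpr ?_
      change (n : ℕ) • galPoint E σ (P : GeomPoint E) = 0
      rw [← map_nsmul, hP, map_zero])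
  map_one' := by
    ext P
    rcases P with ⟨_ | _, hP⟩ <;> rfl
  map_mul' σ τ := by
    ext P
    rcases P with ⟨_ | _, hP⟩ <;> rfl

/-- A choice of coordinates on `E[∞]`: a `ℤ/n`-basis of `E[n]` for every `n ≥ 1`, where the
basis of `E[m]` is `n / m` times the basis of `E[n]` whenever `m ∣ n`. This is the same thing as
a `Ẑ`-basis of `lim E[n]`, and as an isomorphism `E[∞] ≅ (ℚ/ℤ)²`. -/
structure TorsionBasis (E : WeierstrassCurve K) where
  basis : ∀ n : ℕ+, Module.Basis (Fin 2) (ZMod n) (nTorsion E n)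
  compat : ∀ (m n : ℕ+), (m : ℕ) ∣ n → ∀ i,
    (basis m i : GeomPoint E) = ((n : ℕ) / m) • (basis n i : GeomPoint E)

/-- The matrix of `σ` on `E[n]`; its columns are the coordinates of the images of the basis
vectors. -/
def TorsionBasis.matrixMod {E : WeierstrassCurve K} (B : TorsionBasis E) (n : ℕ+) :
    (AlgebraicClosure K ≃ₐ[K] AlgebraicClosure K) →* Matrix (Fin 2) (Fin 2) (ZMod n) :=
  (LinearMap.toMatrixAlgEquiv (B.basis n) :
    Module.End (ZMod n) (nTorsion E n) →* Matrix (Fin 2) (Fin 2) (ZMod n)).comp (galTorsion E n)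

theorem zmod_smul_coe {E : WeierstrassCurve K} (n : ℕ+) (a : ZMod n) (P : nTorsion E n) :
    ((a • P : nTorsion E n) : GeomPoint E) = a.val • (P : GeomPoint E) := by
  conv_lhs => rw [← ZMod.natCast_zmod_val a, Nat.cast_smul_eq_nsmul]
  rfl

theorem TorsionBasis.matrixMod_apply {E : WeierstrassCurve K} (B : TorsionBasis E) (n : ℕ+)
    (σ : AlgebraicClosure K ≃ₐ[K] AlgebraicClosure K) (i j : Fin 2) :
    B.matrixMod n σ i j = (B.basis n).repr (galTorsion E n σ (B.basis n j)) i :=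
  LinearMap.toMatrixAlgEquiv_apply (B.basis n) (galTorsion E n σ) i j

theorem TorsionBasis.galPoint_basis {E : WeierstrassCurve K} (B : TorsionBasis E) (n : ℕ+)
    (σ : AlgebraicClosure K ≃ₐ[K] AlgebraicClosure K) (j : Fin 2) :
    galPoint E σ (B.basis n j) =
      ∑ i, (B.matrixMod n σ i j).val • (B.basis n i : GeomPoint E) := by
  have h := (B.basis n).sum_repr (galTorsion E n σ (B.basis n j))
  have h' := congrArg (Subtype.val : nTorsion E n → GeomPoint E) h
  rw [AddSubgroup.val_finsetSum] at h'
  simp only [zmod_smul_coe, ← B.matrixMod_apply] at h'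
  exact h'.symm

theorem TorsionBasis.matrixMod_compat {E : WeierstrassCurve K} (B : TorsionBasis E)
    (σ : AlgebraicClosure K ≃ₐ[K] AlgebraicClosure K) (i j : Fin 2) (m n : ℕ+)
    (h : (m : ℕ) ∣ n) :
    ZMod.castHom h (ZMod m) (B.matrixMod n σ i j) = B.matrixMod m σ i j := by
  have key : galTorsion E m σ (B.basis m j) =
      ∑ i, ZMod.castHom h (ZMod m) (B.matrixMod n σ i j) • B.basis m i := by
    apply Subtype.ext
    rw [AddSubgroup.val_finsetSum]
    change galPoint E σ (B.basis m j) = _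
    rw [B.compat m n h j, map_nsmul, B.galPoint_basis n σ j, Finset.smul_sum]
    refine Finset.sum_congr rfl fun k _ => ?_
    conv_rhs => rw [← ZMod.natCast_zmod_val (B.matrixMod n σ k j), map_natCast,
      Nat.cast_smul_eq_nsmul]
    rw [AddSubgroup.coe_nsmul, B.compat m n h k, smul_comm]
  rw [B.matrixMod_apply m, key, Module.Basis.repr_sum_self]

/-- The adelic Galois representation `ρ_E : Gal(K̄/K) → Aut(E[∞]) ≅ GL(2, Ẑ)`, in the given
coordinates on `E[∞]`. -/
def TorsionBasis.rho {E : WeierstrassCurve K} (B : TorsionBasis E) :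
    (AlgebraicClosure K ≃ₐ[K] AlgebraicClosure K) →* Matrix.GeneralLinearGroup (Fin 2) ZHat :=
  MonoidHom.toHomUnits
    { toFun := fun σ => Matrix.of fun i j =>
        (⟨fun n => B.matrixMod n σ i j, fun m n h => B.matrixMod_compat σ i j m n h⟩ : ZHat)
      map_one' := by
        ext i j n
        simp only [map_one, Matrix.of_apply, Matrix.one_apply]
        split_ifs <;> rfl
      map_mul' := fun σ τ => by
        ext i j n
        simp only [map_mul, Matrix.of_apply, Matrix.mul_apply, Fin.sum_univ_two]
        rfl }

/-- `K^cyc`, the extension of `K` generated by all roots of unity. -/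
def cyc (K : Type*) [Field K] : IntermediateField K (AlgebraicClosure K) :=
  IntermediateField.adjoin K {z | IsOfFinOrder z}

/-- `ρ_E(G_{K^cyc}) = SL(2, Ẑ)`. Since `SL(2, Ẑ)` is normal in `GL(2, Ẑ)`, this does not depend
on the coordinates chosen on `E[∞]`. -/
def AdelicImageIsSL (E : WeierstrassCurve K) : Prop :=
  ∃ B : TorsionBasis E, (cyc K).fixingSubgroup.map B.rho =
    (Matrix.SpecialLinearGroup.toGL (n := Fin 2) (R := ZHat)).range

/-! ### Rational functions on the curve -/

/-- The function `x` in the function field `K(E)`. -/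
def xFun (E : WeierstrassCurve K) : E.toAffine.FunctionField :=
  algebraMap E.toAffine.CoordinateRing _ (Affine.CoordinateRing.mk E.toAffine (Polynomial.C .X))

/-- The function `y` in the function field `K(E)`. -/
def yFun (E : WeierstrassCurve K) : E.toAffine.FunctionField :=
  algebraMap E.toAffine.CoordinateRing _ (Affine.CoordinateRing.mk E.toAffine .X)

/-- The endomorphism `[-1]^*` of the coordinate ring: `x ↦ x`, `y ↦ -y - a₁x - a₃`. -/
def negCoord (E : WeierstrassCurve K) :
    E.toAffine.CoordinateRing →ₐ[Polynomial K] E.toAffine.CoordinateRing :=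
  AdjoinRoot.liftAlgHom E.toAffine.polynomial (Algebra.ofId _ _)
    (Affine.CoordinateRing.mk E.toAffine E.toAffine.negPolynomial) (by
      have hc : E.toAffine.polynomial.comp E.toAffine.negPolynomial = E.toAffine.polynomial := by
        simp only [Affine.polynomial, Affine.negPolynomial, Polynomial.sub_comp,
          Polynomial.add_comp, Polynomial.mul_comp, Polynomial.pow_comp, Polynomial.X_comp,
          Polynomial.C_comp]
        ring
      have h := Polynomial.hom_eval₂ E.toAffine.polynomial Polynomial.C
        (AdjoinRoot.mk E.toAffine.polynomial) E.toAffine.negPolynomial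
      rw [← Polynomial.comp, hc, AdjoinRoot.mk_self] at h
      exact h.symm)

theorem negCoord_negCoord (E : WeierstrassCurve K) :
    (negCoord E).comp (negCoord E) = AlgHom.id (Polynomial K) _ := by
  refine AdjoinRoot.algHom_ext ?_
  have hr : negCoord E (AdjoinRoot.root E.toAffine.polynomial) =
      Affine.CoordinateRing.mk E.toAffine E.toAffine.negPolynomial :=
    AdjoinRoot.liftAlgHom_root _ _ _ _
  have hC : ∀ p : Polynomial K, negCoord E (AdjoinRoot.mk E.toAffine.polynomial (.C p)) =
      AdjoinRoot.mk E.toAffine.polynomial (.C p) := fun p => (negCoord E).commutes p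
  rw [AlgHom.comp_apply, hr, AlgHom.id_apply, Affine.negPolynomial, map_sub, map_neg, map_sub,
    map_neg, hC]
  change -negCoord E (AdjoinRoot.root _) - _ = _
  rw [hr, Affine.negPolynomial, map_sub, map_neg, AdjoinRoot.mk_X]
  ring

/-- The automorphism `[-1]^*` of the function field `K(E)`: `x ↦ x`, `y ↦ -y - a₁x - a₃`. -/
def negFun (E : WeierstrassCurve K) : E.toAffine.FunctionField ≃+* E.toAffine.FunctionField :=
  IsFractionRing.ringEquivOfRingEquiv
    (AlgEquiv.ofAlgHom (negCoord E) (negCoord E) (negCoord_negCoord E)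
      (negCoord_negCoord E)).toRingEquiv

/-- The rational function `f` on `E` is even: `f ∘ [-1] = f`. -/
def IsEven (E : WeierstrassCurve K) (f : E.toAffine.FunctionField) : Prop := negFun E f = f

/-- The degree `[K(E) : K(f)]` of the morphism `f : E → ℙ¹` (with value `0` if `f` is constant). -/
def degree (E : WeierstrassCurve K) (f : E.toAffine.FunctionField) : ℕ :=
  Module.finrank (IntermediateField.adjoin K {f}) E.toAffine.FunctionField

/-- Homogeneous coordinates of a point; the origin is `(0 : 1 : 0)`. -/
def homCoords (E : WeierstrassCurve K) : GeomPoint E → Fin 3 → AlgebraicClosure K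
  | .zero => ![0, 1, 0]
  | .some x y _ => ![x, y, 1]

/-- `f` is regular at `P` with value `c`: there are homogeneous polynomials `F`, `G` of the same
degree over `K` with `G(P) ≠ 0`, `f = F / G` in `K(E)`, and `c = F(P) / G(P)`. -/
def HasValueAt (E : WeierstrassCurve K) (f : E.toAffine.FunctionField) (P : GeomPoint E)
    (c : AlgebraicClosure K) : Prop :=
  ∃ (d : ℕ) (F G : MvPolynomial (Fin 3) K), F.IsHomogeneous d ∧ G.IsHomogeneous d ∧
    MvPolynomial.aeval (homCoords E P) G ≠ 0 ∧
    f * MvPolynomial.aeval ![xFun E, yFun E, 1] G = MvPolynomial.aeval ![xFun E, yFun E, 1] F ∧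
    c = MvPolynomial.aeval (homCoords E P) F / MvPolynomial.aeval (homCoords E P) G

/-- The map `E(K̄) → ℙ¹(K̄) = K̄ ∪ {∞}` given by the rational function `f`: where `f` is regular
it takes the value of `f`, and at the poles of `f` it takes the value `∞`. -/
def toP1 (E : WeierstrassCurve K) (f : E.toAffine.FunctionField) (P : GeomPoint E) :
    OnePoint (AlgebraicClosure K) :=
  if h : ∃ c, HasValueAt E f P c then ((h.choose : AlgebraicClosure K) : OnePoint _)
  else OnePoint.infty

end ProjTorsion

end

/-! An even function on `E` lies in `K(x)`. If it has degree 2, then `2 = [K(E) : K(x)] [K(x) :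
K(f)]` with the first factor not 1, so `f` is a fractional linear function of `x` over `K`
(`exists_moebius`). Hence `f(P) = f(Q)` iff `P = ±Q` (`toP1_eq_iff`), and `f` commutes with Galois
(`toP1_galPoint`).

Let `π₁(P₁) = π₂(P₂)` with `P₁`, `P₂` of orders `m`, `n`. Complete `P₁` to a basis `P₁, Q₁` of
`E₁[m]` and take `σ` over `K^cyc` with `σP₁ = P₁`, `σQ₁ = Q₁ + P₁`. It fixes the common value, so
`σP₂ = ±P₂`; having determinant 1, it acts on `E₂[n]` as a sign times a unipotent matrix, and `σ^n`
acts there as `±1`. Some `τ` takes `P₁` to `Q₁`, so `π₁(Q₁) = π₂(τP₂)` is fixed by `σ^n`. Thus `Q₁ +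
nP₁ = ±Q₁`, which forces `m ∣ n` (`IsFrame.dvd_of_toP1_eq`). By symmetry `m = n`.

Galois is transitive on points of exact order `n`, so a single common value makes the images of
`E₁*[n]` and `E₂*[n]` coincide. Condition (B) leaves only `n = 1`, the origins. -/

noncomputable section

open scoped Classical

namespace ProjTorsion

open WeierstrassCurve

variable {K : Type*} [Field K]

/-! ### Even functions of degree two -/

/-- The inclusion of the coordinate ring in the function field. -/
abbrev toFun (E : WeierstrassCurve K) : E.toAffine.CoordinateRing →+* E.toAffine.FunctionField :=
  algebraMap E.toAffine.CoordinateRing E.toAffine.FunctionField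

theorem toFun_injective (E : WeierstrassCurve K) : Function.Injective (toFun E) :=
  IsFractionRing.injective _ _

theorem negCoord_Y (E : WeierstrassCurve K) :
    negCoord E (Affine.CoordinateRing.mk E.toAffine .X) =
      Affine.CoordinateRing.mk E.toAffine E.toAffine.negPolynomial :=
  AdjoinRoot.liftAlgHom_root _ _ _ _

theorem negFun_toFun (E : WeierstrassCurve K) (z : E.toAffine.CoordinateRing) :
    negFun E (toFun E z) = toFun E (negCoord E z) :=
  IsFractionRing.ringEquivOfRingEquiv_algebraMap _ _

/-- The cofactor `w` is the conjugate of `z` under `y ↦ -y - a₁x - a₃`, and `N` is the norm of `z`.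
This makes denominators polynomials in `x`. -/
theorem exists_norm_mul (E : WeierstrassCurve K) (z : E.toAffine.CoordinateRing) (hz : z ≠ 0) :
    ∃ (N : Polynomial K) (w : E.toAffine.CoordinateRing), N ≠ 0 ∧
      z * w = Affine.CoordinateRing.mk E.toAffine (.C N) := by
  obtain ⟨p, q, rfl⟩ := Affine.CoordinateRing.exists_smul_basis_eq z
  have : Module.Finite (Polynomial K) E.toAffine.CoordinateRing :=
    .of_basis (Affine.CoordinateRing.basis E.toAffine)
  refine ⟨_, .mk _ (.C p + .C q * (-.X - .C (.C E.a₁ * .X + .C E.a₃))),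
    Algebra.norm_ne_zero_iff.mpr hz,
    Eq.trans ?_ (Affine.CoordinateRing.coe_norm_smul_basis p q).symm⟩
  simp only [map_add, map_mul, Affine.CoordinateRing.smul, mul_one]

/-- An even function is a quotient of two polynomials in `x`. -/
theorem IsEven.exists_polynomial [CharZero K] {E : WeierstrassCurve K}
    {f : E.toAffine.FunctionField} (hf : IsEven E f) :
    ∃ p N : Polynomial K, N ≠ 0 ∧
      f * toFun E (Affine.CoordinateRing.mk E.toAffine (.C N)) =
        toFun E (Affine.CoordinateRing.mk E.toAffine (.C p)) := by
  obtain ⟨n, m, hm, rfl⟩ := IsFractionRing.div_surjective (A := E.toAffine.CoordinateRing) f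
  have hm0 : m ≠ 0 := nonZeroDivisors.ne_zero hm
  obtain ⟨N, w, hN, hw⟩ := exists_norm_mul E m hm0
  obtain ⟨p, q, hpq⟩ := Affine.CoordinateRing.exists_smul_basis_eq (n * w)
  have hm1 : toFun E m ≠ 0 := fun h => hm0 (toFun_injective E (by rw [h, map_zero]))
  have key : toFun E n / toFun E m * toFun E (Affine.CoordinateRing.mk E.toAffine (.C N)) =
      toFun E (p • 1 + q • Affine.CoordinateRing.mk E.toAffine .X) := by
    rw [hpq, ← hw, map_mul, map_mul]
    field_simp
  have key2 := congrArg (negFun E) key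
  rw [map_mul, hf, negFun_toFun, negFun_toFun] at key2
  have hNN : negCoord E (Affine.CoordinateRing.mk E.toAffine (.C N)) =
      Affine.CoordinateRing.mk E.toAffine (.C N) := (negCoord E).commutes N
  rw [hNN, key] at key2
  have key3 := toFun_injective E key2
  rw [map_add, map_smul, map_smul, map_one, negCoord_Y, Affine.negPolynomial] at key3
  -- The numerator `p + qy` equals its image under `[-1]`; the difference is `q(a₁x + a₃) + 2qy =
  -- 0`, and `2 ≠ 0` gives `q = 0`.
  have key4 : (q * (.C E.a₁ * .X + .C E.a₃)) • (1 : E.toAffine.CoordinateRing) +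
      (2 * q) • Affine.CoordinateRing.mk E.toAffine .X = 0 := by
    simp only [Affine.CoordinateRing.smul, map_sub, map_neg, map_mul, map_ofNat, mul_one] at key3 ⊢
    linear_combination key3
  have hq := (Affine.CoordinateRing.smul_basis_eq_zero key4).2
  have hq0 : q = 0 := by simpa using hq
  refine ⟨p, N, hN, ?_⟩
  rw [key, hq0, zero_smul, add_zero, Affine.CoordinateRing.smul, mul_one]

theorem coordX_injective (E : WeierstrassCurve K) : Function.Injective fun p : Polynomial K =>
    toFun E (Affine.CoordinateRing.mk E.toAffine (.C p)) := fun p q h => by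
  have h1 := toFun_injective E h
  have := Affine.CoordinateRing.smul_basis_eq_zero (W' := E.toAffine) (p := p - q) (q := 0) (by
    simp only [Affine.CoordinateRing.smul, map_sub, map_zero]
    linear_combination h1)
  exact sub_eq_zero.mp this.1

/-- The inclusion `K(X) → K(E)`, `X ↦ x`. -/
def ratFuncHom (E : WeierstrassCurve K) : RatFunc K →ₐ[K] E.toAffine.FunctionField :=
  RatFunc.liftAlgHom (IsScalarTower.toAlgHom K (Polynomial K) E.toAffine.FunctionField)
    (nonZeroDivisors_le_comap_nonZeroDivisors_of_injective _ (coordX_injective E))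

theorem ratFuncHom_div (E : WeierstrassCurve K) (p q : Polynomial K) :
    ratFuncHom E (algebraMap _ _ p / algebraMap _ _ q) =
      toFun E (Affine.CoordinateRing.mk E.toAffine (.C p)) /
        toFun E (Affine.CoordinateRing.mk E.toAffine (.C q)) :=
  RatFunc.liftAlgHom_apply_div _ _ _ _

theorem coordX_ne_zero (E : WeierstrassCurve K) {N : Polynomial K} (hN : N ≠ 0) :
    toFun E (Affine.CoordinateRing.mk E.toAffine (.C N)) ≠ 0 := fun h =>
  hN (coordX_injective E (by simpa using h))

/-- A quotient of polynomials in `x` equal to `y` would be a linear relation between the basis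
elements `1, y` of the coordinate ring over `K[x]`. -/
theorem yFun_notMem (E : WeierstrassCurve K) : yFun E ∉ (ratFuncHom E).fieldRange := by
  rintro ⟨r, hr⟩
  change ratFuncHom E r = _ at hr
  rw [← RatFunc.num_div_denom r, ratFuncHom_div, div_eq_iff
    (coordX_ne_zero E r.denom_ne_zero), yFun, ← map_mul] at hr
  have := Affine.CoordinateRing.smul_basis_eq_zero (W' := E.toAffine) (p := r.num) (q := -r.denom)
    (by
      simp only [Affine.CoordinateRing.smul, map_neg]
      linear_combination toFun_injective E hr)
  exact r.denom_ne_zero (neg_eq_zero.mp this.2)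

/-- In the tower `K(f) ⊆ K(x) ⊆ K(E)` of total degree 2 the upper step is not trivial, since it
misses `y`, so the lower one is. The degree of `K(X)` over `K(r)` is the larger of the degrees of
numerator and denominator. -/
theorem max_natDegree_eq_one_of_degree_eq_two {E : WeierstrassCurve K} (r : RatFunc K)
    (hd : degree E (ratFuncHom E r) = 2) :
    max r.num.natDegree r.denom.natDegree = 1 := by
  rw [← RatFunc.finrank_eq_max_natDegree]
  have hmap : (IntermediateField.adjoin K {r}).map (ratFuncHom E) =
      IntermediateField.adjoin K {ratFuncHom E r} := by
    rw [IntermediateField.adjoin_map, Set.image_singleton]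
  have hle : IntermediateField.adjoin K {ratFuncHom E r} ≤ (ratFuncHom E).fieldRange := by
    rw [IntermediateField.adjoin_simple_le_iff]
    exact ⟨r, rfl⟩
  have h := IntermediateField.relfinrank_mul_finrank_top hle
  have h2 : Module.finrank (IntermediateField.adjoin K {ratFuncHom E r})
      E.toAffine.FunctionField = 2 := hd
  rw [h2, ← hmap, AlgHom.fieldRange_eq_map, IntermediateField.relfinrank_map_map,
    IntermediateField.relfinrank_top_right, ← AlgHom.fieldRange_eq_map] at h
  have h3 : Module.finrank (ratFuncHom E).fieldRange E.toAffine.FunctionField ≠ 1 := fun h1 => by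
    have := IntermediateField.finrank_eq_one_iff_eq_top.mp h1
    exact yFun_notMem E (this ▸ IntermediateField.mem_top)
  have h4 : Module.finrank (IntermediateField.adjoin K {r}) (RatFunc K) ∣ 2 := ⟨_, h.symm⟩
  rcases (Nat.dvd_prime Nat.prime_two).mp h4 with h5 | h5
  · exact h5
  · rw [h5] at h
    omega

/-- An even function of degree two is a fractional linear function of `x`. -/
theorem exists_moebius [CharZero K] {E : WeierstrassCurve K} {f : E.toAffine.FunctionField}
    (hf : IsEven E f) (hd : degree E f = 2) :
    ∃ a b c d : K, a * d - b * c ≠ 0 ∧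
      f * (algebraMap K _ c * xFun E + algebraMap K _ d) =
        algebraMap K _ a * xFun E + algebraMap K _ b := by
  obtain ⟨p, N, hN, hpN⟩ := hf.exists_polynomial
  obtain ⟨r, hr⟩ : ∃ r : RatFunc K, ratFuncHom E r = f := by
    refine ⟨algebraMap _ _ p / algebraMap _ _ N, ?_⟩
    rw [ratFuncHom_div, ← hpN, mul_div_cancel_right₀ _ (coordX_ne_zero E hN)]
  subst hr
  have hmax := max_natDegree_eq_one_of_degree_eq_two r hd
  obtain ⟨a, b, hab⟩ := Polynomial.exists_eq_X_add_C_of_natDegree_le_one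
    (p := r.num) (hmax ▸ le_max_left _ _)
  obtain ⟨c, d, hcd⟩ := Polynomial.exists_eq_X_add_C_of_natDegree_le_one
    (p := r.denom) (hmax ▸ le_max_right _ _)
  have hlin : ∀ a b : K, toFun E (Affine.CoordinateRing.mk E.toAffine
      (.C (.C a * .X + .C b))) = algebraMap K _ a * xFun E + algebraMap K _ b := fun a b => by
    rw [map_add, map_add, map_add, map_mul, map_mul, map_mul]
    rfl
  refine ⟨a, b, c, d, fun h0 => ?_, ?_⟩
  · obtain ⟨u, v, huv⟩ := r.isCoprime_num_denom
    -- A zero determinant makes numerator and denominator proportional; being coprime, neither can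
    -- have degree 1, against `hmax`.
    have hc : Polynomial.C c * r.num = Polynomial.C a * r.denom := by
      rw [hab, hcd]
      have : (Polynomial.C (a * d - b * c) : Polynomial K) = 0 := by rw [h0, map_zero]
      rw [map_sub, map_mul, map_mul] at this
      linear_combination -this
    have ha : a = 0 := by
      by_contra ha
      have hu : IsUnit r.num := .of_mul_eq_one (Polynomial.C a⁻¹ * (.C a * u + .C c * v)) (by
        have : (Polynomial.C a⁻¹ * Polynomial.C a : Polynomial K) = 1 := by
          rw [← map_mul, inv_mul_cancel₀ ha, map_one]
        linear_combination Polynomial.C a⁻¹ * v * hc + this + Polynomial.C a⁻¹ * .C a * (huv))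
      have := Polynomial.natDegree_eq_zero_of_isUnit hu
      rw [hab, Polynomial.natDegree_linear ha] at this
      exact one_ne_zero this
    have hc0 : c = 0 := by
      by_contra hc'
      have hu : IsUnit r.denom := .of_mul_eq_one (Polynomial.C c⁻¹ * (.C a * u + .C c * v)) (by
        have : (Polynomial.C c⁻¹ * Polynomial.C c : Polynomial K) = 1 := by
          rw [← map_mul, inv_mul_cancel₀ hc', map_one]
        linear_combination -Polynomial.C c⁻¹ * u * hc + this + Polynomial.C c⁻¹ * .C c * (huv))
      have := Polynomial.natDegree_eq_zero_of_isUnit hu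
      rw [hcd, Polynomial.natDegree_linear hc'] at this
      exact one_ne_zero this
    rw [hab, hcd, ha, hc0] at hmax
    simp at hmax
  · rw [← hlin, ← hlin, ← hab, ← hcd]
    rw [← div_mul_cancel₀ (toFun E (Affine.CoordinateRing.mk E.toAffine (.C r.num)))
      (coordX_ne_zero E r.denom_ne_zero), ← ratFuncHom_div, RatFunc.num_div_denom]

/-! ### Values of fractional linear functions of `x` -/

/-- The homogeneous coordinates of the generic point, in the coordinate ring. -/
def genericCoords (E : WeierstrassCurve K) : Fin 3 → E.toAffine.CoordinateRing :=
  ![Affine.CoordinateRing.mk E.toAffine (.C .X), Affine.CoordinateRing.mk E.toAffine .X, 1]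

theorem toFun_aeval_genericCoords (E : WeierstrassCurve K) (F : MvPolynomial (Fin 3) K) :
    toFun E (MvPolynomial.aeval (genericCoords E) F) =
      MvPolynomial.aeval ![xFun E, yFun E, 1] F := by
  have h := MvPolynomial.comp_aeval_apply (genericCoords E)
    (IsScalarTower.toAlgHom K E.toAffine.CoordinateRing E.toAffine.FunctionField) F
  refine h.trans ?_
  congr 2
  funext i
  fin_cases i
  · rfl
  · rfl
  · exact map_one (toFun E)

theorem generic_equation (E : WeierstrassCurve K) :
    genericCoords E 1 ^ 2 + algebraMap K _ E.a₁ * genericCoords E 0 * genericCoords E 1 +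
      algebraMap K _ E.a₃ * genericCoords E 1 =
    genericCoords E 0 ^ 3 + algebraMap K _ E.a₂ * genericCoords E 0 ^ 2 +
      algebraMap K _ E.a₄ * genericCoords E 0 + algebraMap K _ E.a₆ := by
  have h : Affine.CoordinateRing.mk E.toAffine (.X ^ 2 + .C (.C E.a₁ * .X + .C E.a₃) * .X -
      .C (.X ^ 3 + .C E.a₂ * .X ^ 2 + .C E.a₄ * .X + .C E.a₆)) = 0 := AdjoinRoot.mk_self
  simp only [map_add, map_sub, map_mul, map_pow] at h
  exact sub_eq_zero.mp (Eq.trans (by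
    simp only [genericCoords, Matrix.cons_val_zero, Matrix.cons_val_one]
    change _ = _ ^ 2 + (algebraMap K _ E.a₁ * _ + algebraMap K _ E.a₃) * _ -
      (_ ^ 3 + algebraMap K _ E.a₂ * _ ^ 2 + algebraMap K _ E.a₄ * _ + algebraMap K _ E.a₆)
    ring) h)

/-- Evaluation of regular functions at an affine point. -/
theorem exists_evalHom (E : WeierstrassCurve K) {x y : AlgebraicClosure K}
    (h : (E.toAffine.baseChange (AlgebraicClosure K)).Nonsingular x y) :
    ∃ ev : E.toAffine.CoordinateRing →ₐ[K] AlgebraicClosure K, ∀ F : MvPolynomial (Fin 3) K,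
      ev (MvPolynomial.aeval (genericCoords E) F) = MvPolynomial.aeval ![x, y, 1] F := by
  have heq : y ^ 2 + algebraMap K _ E.a₁ * x * y + algebraMap K _ E.a₃ * y =
      x ^ 3 + algebraMap K _ E.a₂ * x ^ 2 + algebraMap K _ E.a₄ * x + algebraMap K _ E.a₆ :=
    (Affine.equation_iff ..).mp h.1
  have hroot : Polynomial.eval₂ ((Polynomial.aeval x : Polynomial K →ₐ[K] AlgebraicClosure K) :
      Polynomial K →+* AlgebraicClosure K) y E.toAffine.polynomial = 0 := by
    simp only [Affine.polynomial, Polynomial.eval₂_add, Polynomial.eval₂_sub, Polynomial.eval₂_mul,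
      Polynomial.eval₂_pow, Polynomial.eval₂_X, Polynomial.eval₂_C, RingHom.coe_coe, map_add,
      map_mul, map_pow, Polynomial.aeval_X, Polynomial.aeval_C]
    linear_combination heq
  refine ⟨AdjoinRoot.liftAlgHom E.toAffine.polynomial (Polynomial.aeval x) y hroot, fun F => ?_⟩
  rw [MvPolynomial.comp_aeval_apply]
  congr 2
  funext i
  fin_cases i
  · exact (AdjoinRoot.liftAlgHom_of ..).trans (Polynomial.aeval_X x)
  · exact AdjoinRoot.liftAlgHom_root ..
  · exact map_one _

/-- The order of the pole at the origin. -/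
def poleOrder {E : WeierstrassCurve K} (z : E.toAffine.CoordinateRing) : WithBot ℕ :=
  (Algebra.norm (Polynomial K) z).degree

/-! ### Pole order at the origin as the degree of the norm to `K[x]` -/

section PoleOrder

variable {E : WeierstrassCurve K}

theorem poleOrder_mul (z w : E.toAffine.CoordinateRing) :
    poleOrder (z * w) = poleOrder z + poleOrder w := by
  rw [poleOrder, map_mul, Polynomial.degree_mul]; rfl

theorem poleOrder_pow (z : E.toAffine.CoordinateRing) (n : ℕ) :
    poleOrder (z ^ n) = n • poleOrder z := by
  rw [poleOrder, map_pow, Polynomial.degree_pow]; rfl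

/-- The norm of `p + qy` has degree `max (2 deg p) (2 deg q + 3)`, so the bound reduces to the one
for degrees of polynomials. -/
theorem poleOrder_add_le (z w : E.toAffine.CoordinateRing) :
    poleOrder (z + w) ≤ max (poleOrder z) (poleOrder w) := by
  obtain ⟨p, q, rfl⟩ := Affine.CoordinateRing.exists_smul_basis_eq z
  obtain ⟨p', q', rfl⟩ := Affine.CoordinateRing.exists_smul_basis_eq w
  have : p • (1 : E.toAffine.CoordinateRing) + q • Affine.CoordinateRing.mk E.toAffine .X +
      (p' • (1 : E.toAffine.CoordinateRing) + q' • Affine.CoordinateRing.mk E.toAffine .X) =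
      (p + p') • (1 : E.toAffine.CoordinateRing) +
        (q + q') • Affine.CoordinateRing.mk E.toAffine .X := by
    simp only [add_smul]; abel
  rw [this]
  simp only [poleOrder, Affine.CoordinateRing.degree_norm_smul_basis]
  have h1 := Polynomial.degree_add_le p p'
  have h2 := Polynomial.degree_add_le q q'
  rcases le_max_iff.mp h1 with h1 | h1 <;> rcases le_max_iff.mp h2 with h2 | h2
  · exact le_max_of_le_left (max_le_max (nsmul_le_nsmul_right h1 2) (by gcongr))
  · exact max_le (le_max_of_le_left (le_max_of_le_left (nsmul_le_nsmul_right h1 2)))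
      (le_max_of_le_right (le_max_of_le_right (by gcongr)))
  · exact max_le (le_max_of_le_right (le_max_of_le_left (nsmul_le_nsmul_right h1 2)))
      (le_max_of_le_left (le_max_of_le_right (by gcongr)))
  · exact le_max_of_le_right (max_le_max (nsmul_le_nsmul_right h1 2) (by gcongr))

theorem poleOrder_zero : poleOrder (0 : E.toAffine.CoordinateRing) = ⊥ := by
  have : Module.Finite (Polynomial K) E.toAffine.CoordinateRing :=
    .of_basis (Affine.CoordinateRing.basis E.toAffine)
  rw [poleOrder, Algebra.norm_zero, Polynomial.degree_zero]

theorem poleOrder_coordX : poleOrder (genericCoords E 0) = 2 := by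
  have h := Affine.CoordinateRing.degree_norm_smul_basis (W' := E.toAffine) .X 0
  rw [zero_smul, add_zero, Affine.CoordinateRing.smul, mul_one] at h
  refine Eq.trans h ?_
  rw [Polynomial.degree_X, Polynomial.degree_zero]
  rfl

theorem poleOrder_coordY : poleOrder (genericCoords E 1) = 3 := by
  have h := Affine.CoordinateRing.degree_norm_smul_basis (W' := E.toAffine) 0 1
  rw [zero_smul, zero_add, one_smul] at h
  refine Eq.trans h ?_
  rw [Polynomial.degree_one, Polynomial.degree_zero]
  rfl

theorem poleOrder_algebraMap {a : K} (ha : a ≠ 0) :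
    poleOrder (algebraMap K E.toAffine.CoordinateRing a) = 0 := by
  have h := Affine.CoordinateRing.degree_norm_smul_basis (W' := E.toAffine) (.C a) 0
  rw [zero_smul, add_zero, Affine.CoordinateRing.smul, mul_one] at h
  refine Eq.trans h ?_
  rw [Polynomial.degree_C ha, Polynomial.degree_zero]
  rfl

theorem poleOrder_algebraMap_le (a : K) :
    poleOrder (algebraMap K E.toAffine.CoordinateRing a) ≤ 0 := by
  by_cases ha : a = 0
  · rw [ha, map_zero, poleOrder_zero]; exact bot_le
  · exact (poleOrder_algebraMap ha).le

theorem poleOrder_algebraMap_mul_le (a : K) (z : E.toAffine.CoordinateRing) :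
    poleOrder (algebraMap K E.toAffine.CoordinateRing a * z) ≤ poleOrder z := by
  rw [poleOrder_mul]
  exact (add_le_add_left (poleOrder_algebraMap_le a) _).trans (zero_add _).le

theorem poleOrder_sum_lt {ι : Type*} (s : Finset ι) (g : ι → E.toAffine.CoordinateRing) (n : ℕ)
    (h : ∀ i ∈ s, poleOrder (g i) < n) : poleOrder (∑ i ∈ s, g i) < n := by
  induction s using Finset.induction_on with
  | empty => rw [Finset.sum_empty, poleOrder_zero]; exact WithBot.bot_lt_coe n
  | insert a s ha ih =>
    rw [Finset.sum_insert ha]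
    exact (poleOrder_add_le _ _).trans_lt (max_lt (h a (Finset.mem_insert_self a s))
      (ih fun i hi => h i (Finset.mem_insert_of_mem hi)))

/-- A form of degree `d` has a pole of order at most `3d` at the origin, with leading
coefficient its value at the origin. -/
theorem poleOrder_aeval_sub_lt {d : ℕ} {F : MvPolynomial (Fin 3) K} (hF : F.IsHomogeneous d) :
    poleOrder (MvPolynomial.aeval (genericCoords E) F -
      algebraMap K _ (MvPolynomial.aeval ![(0 : K), 1, 0] F) * genericCoords E 1 ^ d) <
        ((3 * d : ℕ) : WithBot ℕ) := by
  rw [MvPolynomial.aeval_def, MvPolynomial.aeval_def, MvPolynomial.eval₂_eq', MvPolynomial.eval₂_eq',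
    map_sum, Finset.sum_mul, ← Finset.sum_sub_distrib]
  refine poleOrder_sum_lt _ _ _ fun m hm => ?_
  have hdeg : m 0 + m 1 + m 2 = d := by
    have := hF (MvPolynomial.mem_support_iff.mp hm)
    rw [Finsupp.weight_apply, Finsupp.sum_fintype _ _ (by simp),
      Fin.sum_univ_three] at this
    simpa using this
  rw [Fin.prod_univ_three, Fin.prod_univ_three]
  have h2 : genericCoords E 2 = 1 := rfl
  rw [h2, one_pow, mul_one]
  simp only [Matrix.cons_val_zero, Matrix.cons_val_one, Matrix.cons_val, one_pow, mul_one]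
  -- A monomial `XⁱYʲZᵏ` of degree `d` has pole order `2i + 3j`, which is below `3d` unless `i = k =
  -- 0`; the excepted monomial `Yᵈ` is the one subtracted.
  by_cases h0 : m 0 = 0 ∧ m 2 = 0
  · have h1 : m 1 = d := by omega
    rw [h0.1, h0.2, h1]
    simp only [pow_zero, one_mul, mul_one, Algebra.algebraMap_self, RingHom.id_apply, sub_self,
      poleOrder_zero]
    exact WithBot.bot_lt_coe _
  · have hz : (0 : K) ^ m 0 * 0 ^ m 2 = 0 := by
      rcases not_and_or.mp h0 with h | h <;> simp [h]
    rw [hz, mul_zero, map_zero (algebraMap K E.toAffine.CoordinateRing), zero_mul, sub_zero]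
    refine (poleOrder_algebraMap_mul_le _ _).trans_lt ?_
    rw [poleOrder_mul, poleOrder_pow, poleOrder_pow, poleOrder_coordX, poleOrder_coordY,
      nsmul_eq_mul, nsmul_eq_mul]
    norm_cast
    omega

theorem poleOrder_linear_le (a b : K) : poleOrder (algebraMap K E.toAffine.CoordinateRing a *
    genericCoords E 0 + algebraMap K _ b) ≤ 2 := by
  refine (poleOrder_add_le _ _).trans (max_le ?_ ?_)
  · exact (poleOrder_algebraMap_mul_le _ _).trans poleOrder_coordX.le
  · exact (poleOrder_algebraMap_le b).trans (by norm_num)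

theorem poleOrder_mul_lt {z w : E.toAffine.CoordinateRing} {m n : ℕ}
    (hz : poleOrder z ≤ m) (hw : poleOrder w < n) : poleOrder (z * w) < ((m + n : ℕ) : WithBot ℕ) := by
  rw [poleOrder_mul]
  generalize poleOrder z = u at *
  generalize poleOrder w = v at *
  cases u <;> cases v
  · exact WithBot.bot_lt_coe _
  · exact WithBot.bot_lt_coe _
  · exact WithBot.bot_lt_coe _
  · have h1 := WithBot.coe_le_coe.mp hz
    have h2 := WithBot.coe_lt_coe.mp hw
    exact WithBot.coe_lt_coe.mpr (add_lt_add_of_le_of_lt h1 h2)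

end PoleOrder

/-- The function `x` on `E(K̄)`, as a map to `ℙ¹(K̄)`. -/
def xCoord (E : WeierstrassCurve K) : GeomPoint E → OnePoint (AlgebraicClosure K)
  | .zero => OnePoint.infty
  | .some x _ _ => (x : OnePoint _)

/-- `toP1` takes a value by choice, so uniqueness of the value has to be supplied along with
existence. -/
theorem toP1_eq_coe {E : WeierstrassCurve K} {f : E.toAffine.FunctionField} {P : GeomPoint E}
    {c : AlgebraicClosure K} (hc : HasValueAt E f P c) (huniq : ∀ c', HasValueAt E f P c' → c' = c) :
    toP1 E f P = (c : OnePoint _) := by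
  have h : ∃ c, HasValueAt E f P c := ⟨c, hc⟩
  rw [toP1, dif_pos h, huniq _ h.choose_spec]

theorem toP1_eq_infty {E : WeierstrassCurve K} {f : E.toAffine.FunctionField} {P : GeomPoint E}
    (h : ∀ c, ¬ HasValueAt E f P c) : toP1 E f P = OnePoint.infty := by
  rw [toP1, dif_neg (fun ⟨c, hc⟩ => h c hc)]

/-! ### Fractional linear functions of `x` as maps to the projective line -/

section Moebius

variable {E : WeierstrassCurve K} {f : E.toAffine.FunctionField} {a b c d : K}

/-- Cross-multiplying moves the identity from the function field to the coordinate ring, where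
evaluation at points and pole orders are available. -/
theorem coordinateRing_relation
    (hf : f * (algebraMap K _ c * xFun E + algebraMap K _ d) =
      algebraMap K _ a * xFun E + algebraMap K _ b) {F G : MvPolynomial (Fin 3) K}
    (hFG : f * MvPolynomial.aeval ![xFun E, yFun E, 1] G =
      MvPolynomial.aeval ![xFun E, yFun E, 1] F) :
    (algebraMap K _ a * genericCoords E 0 + algebraMap K _ b) *
        MvPolynomial.aeval (genericCoords E) G =
      MvPolynomial.aeval (genericCoords E) F *
        (algebraMap K _ c * genericCoords E 0 + algebraMap K _ d) := by
  apply toFun_injective E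
  rw [map_mul, map_mul, toFun_aeval_genericCoords, toFun_aeval_genericCoords]
  simp only [map_add, map_mul]
  change (algebraMap K _ a * xFun E + algebraMap K _ b) * _ =
    _ * (algebraMap K _ c * xFun E + algebraMap K _ d)
  rw [← hf, ← hFG]
  ring

theorem HasValueAt.some_mul
    (hf : f * (algebraMap K _ c * xFun E + algebraMap K _ d) =
      algebraMap K _ a * xFun E + algebraMap K _ b) {x y v : AlgebraicClosure K}
    {h : (E.toAffine.baseChange (AlgebraicClosure K)).Nonsingular x y}
    (hv : HasValueAt E f (.some x y h) v) :
    v * (algebraMap K _ c * x + algebraMap K _ d) = algebraMap K _ a * x + algebraMap K _ b := by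
  obtain ⟨n, F, G, -, -, hG0, hFG, rfl⟩ := hv
  obtain ⟨ev, hev⟩ := exists_evalHom E h
  have hx : ev (genericCoords E 0) = x := by
    have := hev (.X 0)
    simpa using this
  have hrel := congrArg ev (coordinateRing_relation hf hFG)
  simp only [map_mul, map_add, AlgHom.commutes, hev, hx] at hrel
  change MvPolynomial.aeval ![x, y, 1] G ≠ 0 at hG0
  change MvPolynomial.aeval ![x, y, 1] F / MvPolynomial.aeval ![x, y, 1] G * _ = _
  rw [div_mul_eq_mul_div, div_eq_iff hG0, hrel]

theorem HasValueAt.zero_mul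
    (hf : f * (algebraMap K _ c * xFun E + algebraMap K _ d) =
      algebraMap K _ a * xFun E + algebraMap K _ b) {v : AlgebraicClosure K}
    (hv : HasValueAt E f 0 v) : v * algebraMap K _ c = algebraMap K _ a := by
  obtain ⟨n, F, G, hF, hG, hG0, hFG, rfl⟩ := hv
  have hrel := coordinateRing_relation hf hFG
  have hval : ∀ F : MvPolynomial (Fin 3) K, MvPolynomial.aeval (homCoords E 0) F =
      algebraMap K (AlgebraicClosure K) (MvPolynomial.aeval ![(0 : K), 1, 0] F) := fun F => by
    have := MvPolynomial.comp_aeval_apply ![(0 : K), 1, 0]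
      (Algebra.ofId K (AlgebraicClosure K)) F
    refine Eq.trans ?_ this.symm
    congr 2
    funext i
    fin_cases i
    · exact (map_zero _).symm
    · exact (map_one _).symm
    · exact (map_zero _).symm
  rw [hval] at hG0
  rw [hval, hval, div_mul_eq_mul_div, div_eq_iff hG0, ← map_mul, ← map_mul]
  congr 1
  have hF' := poleOrder_aeval_sub_lt (E := E) hF
  have hG' := poleOrder_aeval_sub_lt (E := E) hG
  set u := MvPolynomial.aeval ![(0 : K), 1, 0] F
  set w := MvPolynomial.aeval ![(0 : K), 1, 0] G
  set F' := MvPolynomial.aeval (genericCoords E) F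
  set G' := MvPolynomial.aeval (genericCoords E) G
  set X := genericCoords E 0
  set Y := genericCoords E 1
  by_contra hne
  have hne' : u * c - a * w ≠ 0 := sub_ne_zero.mpr hne
  -- Both sides of `hrel` have pole order at most `3n + 2`. Comparing the coefficients of `XYⁿ`
  -- gives `aw = uc`: otherwise the left side here has order exactly `3n + 2` and every term on the
  -- right a smaller one.
  have hlead : algebraMap K _ (u * c - a * w) * (X * Y ^ n) =
      algebraMap K _ (b * w - d * u) * Y ^ n +
        ((algebraMap K _ a * X + algebraMap K _ b) * (G' - algebraMap K _ w * Y ^ n) +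
        (algebraMap K _ (-c) * X + algebraMap K _ (-d)) * (F' - algebraMap K _ u * Y ^ n)) := by
    simp only [map_sub, map_mul, map_neg]
    linear_combination -hrel
  have hY : poleOrder (Y ^ n) = ((3 * n : ℕ) : WithBot ℕ) := by
    rw [poleOrder_pow, poleOrder_coordY, nsmul_eq_mul]
    norm_cast
    ring
  have h1 : poleOrder (algebraMap K _ (u * c - a * w) * (X * Y ^ n)) =
      ((2 + 3 * n : ℕ) : WithBot ℕ) := by
    rw [poleOrder_mul, poleOrder_mul, poleOrder_algebraMap hne', poleOrder_coordX, hY, zero_add]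
    norm_cast
  refine h1.not_lt ?_
  rw [hlead]
  refine (poleOrder_add_le _ _).trans_lt (max_lt ?_ ((poleOrder_add_le _ _).trans_lt
    (max_lt ?_ ?_)))
  · refine (poleOrder_algebraMap_mul_le _ _).trans_lt ?_
    rw [hY]
    norm_cast
    omega
  · exact poleOrder_mul_lt (poleOrder_linear_le a b) hG'
  · exact poleOrder_mul_lt (poleOrder_linear_le _ _) hF'

theorem isHomogeneous_linear (a b : K) :
    (MvPolynomial.C a * MvPolynomial.X 0 + MvPolynomial.C b * MvPolynomial.X 2 :
      MvPolynomial (Fin 3) K).IsHomogeneous 1 :=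
  ((MvPolynomial.isHomogeneous_X _ _).C_mul a).add ((MvPolynomial.isHomogeneous_X _ _).C_mul b)

theorem hasValueAt_some
    (hf : f * (algebraMap K _ c * xFun E + algebraMap K _ d) =
      algebraMap K _ a * xFun E + algebraMap K _ b) {x y : AlgebraicClosure K}
    (h : (E.toAffine.baseChange (AlgebraicClosure K)).Nonsingular x y)
    (h0 : algebraMap K _ c * x + algebraMap K _ d ≠ 0) :
    HasValueAt E f (.some x y h)
      ((algebraMap K _ a * x + algebraMap K _ b) / (algebraMap K _ c * x + algebraMap K _ d)) := by
  have key : ∀ u : Fin 3 → AlgebraicClosure K, ∀ a b : K, MvPolynomial.aeval u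
      (MvPolynomial.C a * MvPolynomial.X 0 + MvPolynomial.C b * MvPolynomial.X 2) =
        algebraMap K _ a * u 0 + algebraMap K _ b * u 2 := fun u a b => by
    simp only [map_add, map_mul, MvPolynomial.aeval_C, MvPolynomial.aeval_X]
  have key' : ∀ u : Fin 3 → E.toAffine.FunctionField, ∀ a b : K, MvPolynomial.aeval u
      (MvPolynomial.C a * MvPolynomial.X 0 + MvPolynomial.C b * MvPolynomial.X 2) =
        algebraMap K _ a * u 0 + algebraMap K _ b * u 2 := fun u a b => by
    simp only [map_add, map_mul, MvPolynomial.aeval_C, MvPolynomial.aeval_X]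
  have h1 : homCoords E (.some x y h) 0 = x := rfl
  have h2 : homCoords E (.some x y h) 2 = 1 := rfl
  refine ⟨1, _, _, isHomogeneous_linear a b, isHomogeneous_linear c d, ?_, ?_, ?_⟩
  · rw [key, h1, h2, mul_one]
    exact h0
  · rw [key', key']
    simp only [Matrix.cons_val_zero, Matrix.cons_val, mul_one]
    exact hf
  · rw [key, key, h1, h2, mul_one, mul_one]

variable (E) in
/-- The form `Y² + a₁XY + a₃YZ - a₂X² - a₄XZ - a₆Z²`, whose product with `Z` is `X³` on `E`. -/
def cofactorForm : MvPolynomial (Fin 3) K :=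
  MvPolynomial.X 1 ^ 2 + MvPolynomial.C E.a₁ * (MvPolynomial.X 0 * MvPolynomial.X 1) +
    MvPolynomial.C E.a₃ * (MvPolynomial.X 1 * MvPolynomial.X 2) -
    MvPolynomial.C E.a₂ * MvPolynomial.X 0 ^ 2 -
    MvPolynomial.C E.a₄ * (MvPolynomial.X 0 * MvPolynomial.X 2) -
    MvPolynomial.C E.a₆ * MvPolynomial.X 2 ^ 2

theorem aeval_cofactorForm {A : Type*} [CommRing A] [Algebra K A] (u : Fin 3 → A) :
    MvPolynomial.aeval u (cofactorForm E) =
      u 1 ^ 2 + algebraMap K A E.a₁ * (u 0 * u 1) + algebraMap K A E.a₃ * (u 1 * u 2) -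
        algebraMap K A E.a₂ * u 0 ^ 2 - algebraMap K A E.a₄ * (u 0 * u 2) -
        algebraMap K A E.a₆ * u 2 ^ 2 := by
  simp only [cofactorForm, map_add, map_sub, map_mul, map_pow, MvPolynomial.aeval_C,
    MvPolynomial.aeval_X]

theorem isHomogeneous_cofactorForm : (cofactorForm E).IsHomogeneous 2 := by
  have hX : ∀ i : Fin 3, (MvPolynomial.X i : MvPolynomial (Fin 3) K).IsHomogeneous 1 :=
    fun i => MvPolynomial.isHomogeneous_X _ _
  exact ((((((hX 1).pow 2).add (((hX 0).mul (hX 1)).C_mul _)).add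
    (((hX 1).mul (hX 2)).C_mul _)).sub (((hX 0).pow 2).C_mul _)).sub
      (((hX 0).mul (hX 2)).C_mul _)).sub (((hX 2).pow 2).C_mul _)

theorem aeval_cofactorForm_generic :
    MvPolynomial.aeval ![xFun E, yFun E, 1] (cofactorForm E) = xFun E ^ 3 := by
  have h := congrArg (toFun E) (generic_equation E)
  simp only [map_add, map_mul, map_pow] at h
  change yFun E ^ 2 + algebraMap K _ E.a₁ * xFun E * yFun E + algebraMap K _ E.a₃ * yFun E =
    xFun E ^ 3 + algebraMap K _ E.a₂ * xFun E ^ 2 + algebraMap K _ E.a₄ * xFun E +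
      algebraMap K _ E.a₆ at h
  rw [aeval_cofactorForm]
  simp only [Matrix.cons_val_zero, Matrix.cons_val_one, Matrix.cons_val]
  linear_combination h

/-- The forms `aX + bZ` and `cX + dZ` both vanish at the origin. With `C` the cofactor form, `ZC =
X³` on `E`, so `X/Z = C/X²` and `f = (aC + bX²)/(cC + dX²)`, where `C = 1` and `X = 0` at the
origin. -/
theorem hasValueAt_zero
    (hf : f * (algebraMap K _ c * xFun E + algebraMap K _ d) =
      algebraMap K _ a * xFun E + algebraMap K _ b) (h0 : c ≠ 0) :
    HasValueAt E f 0 (algebraMap K _ a / algebraMap K _ c) := by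
  have hom : ∀ a b : K, (MvPolynomial.C a * cofactorForm E +
      MvPolynomial.C b * MvPolynomial.X 0 ^ 2).IsHomogeneous 2 := fun a b =>
    (isHomogeneous_cofactorForm.C_mul a).add
      (((MvPolynomial.isHomogeneous_X K (0 : Fin 3)).pow 2).C_mul b)
  have key : ∀ a b : K, MvPolynomial.aeval (homCoords E 0)
      (MvPolynomial.C a * cofactorForm E + MvPolynomial.C b * MvPolynomial.X 0 ^ 2) =
        algebraMap K _ a := fun a b => by
    have h0 : homCoords E 0 0 = 0 := rfl
    have h1 : homCoords E 0 1 = 1 := rfl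
    have h2 : homCoords E 0 2 = 0 := rfl
    rw [map_add, map_mul, map_mul, map_pow, aeval_cofactorForm, MvPolynomial.aeval_C,
      MvPolynomial.aeval_C, MvPolynomial.aeval_X, h0, h1, h2]
    ring
  have key' : ∀ a b : K, MvPolynomial.aeval ![xFun E, yFun E, 1]
      (MvPolynomial.C a * cofactorForm E + MvPolynomial.C b * MvPolynomial.X 0 ^ 2) =
        algebraMap K _ a * xFun E ^ 3 + algebraMap K _ b * xFun E ^ 2 := fun a b => by
    rw [map_add, map_mul, map_mul, map_pow, aeval_cofactorForm_generic, MvPolynomial.aeval_C,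
      MvPolynomial.aeval_C, MvPolynomial.aeval_X]
    rfl
  refine ⟨2, _, _, hom a b, hom c d, ?_, ?_, ?_⟩
  · rw [key]
    exact (map_ne_zero _).mpr h0
  · rw [key', key']
    linear_combination xFun E ^ 2 * hf
  · rw [key, key]

/-- As the determinant is nonzero, numerator and denominator do not vanish together. Where the
denominator vanishes, `f` therefore has no finite value, and both sides are `∞`. -/
theorem toP1_eq_smul_xCoord (hdet : a * d - b * c ≠ 0)
    (hf : f * (algebraMap K _ c * xFun E + algebraMap K _ d) =
      algebraMap K _ a * xFun E + algebraMap K _ b) (P : GeomPoint E) :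
    toP1 E f P = (Matrix.GeneralLinearGroup.mkOfDetNeZero !![a, b; c, d]
      (by rwa [Matrix.det_fin_two_of])).map (algebraMap K (AlgebraicClosure K)) • xCoord E P := by
  have hdet' : (algebraMap K (AlgebraicClosure K) a * algebraMap K _ d -
      algebraMap K _ b * algebraMap K _ c) ≠ 0 := by
    rw [← map_mul, ← map_mul, ← map_sub]
    exact (map_ne_zero _).mpr hdet
  rcases P with _ | ⟨x, y, h⟩
  · rw [xCoord, OnePoint.smul_infty_eq_ite]
    change toP1 E f 0 = if algebraMap K (AlgebraicClosure K) c = 0 then _ else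
      ((algebraMap K (AlgebraicClosure K) a / algebraMap K (AlgebraicClosure K) c : AlgebraicClosure K) : OnePoint _)
    split_ifs with h0
    · refine toP1_eq_infty fun v hv => ?_
      have := hv.zero_mul hf
      rw [h0, mul_zero] at this
      rw [h0, ← this] at hdet'
      simp at hdet'
    · refine toP1_eq_coe (hasValueAt_zero hf (by simpa using h0)) fun v hv => ?_
      rw [eq_div_iff h0, hv.zero_mul hf]
  · rw [xCoord, OnePoint.smul_some_eq_ite]
    change _ = if algebraMap K (AlgebraicClosure K) c * x + algebraMap K _ d = 0 then _ else
      OnePoint.some ((algebraMap K (AlgebraicClosure K) a * x + algebraMap K _ b) /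
        (algebraMap K (AlgebraicClosure K) c * x + algebraMap K _ d))
    split_ifs with h0
    · refine toP1_eq_infty fun v hv => hdet' ?_
      have := hv.some_mul hf
      rw [h0, mul_zero] at this
      linear_combination algebraMap K _ a * h0 + algebraMap K _ c * this
    · refine toP1_eq_coe (hasValueAt_some hf h h0) fun v hv => ?_
      rw [eq_div_iff h0, hv.some_mul hf]

end Moebius

theorem xCoord_eq_iff {E : WeierstrassCurve K} {P Q : GeomPoint E} :
    xCoord E P = xCoord E Q ↔ P = Q ∨ P = -Q := by
  rcases P with _ | ⟨x, y, h⟩ <;> rcases Q with _ | ⟨x', y', h'⟩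
  · exact iff_of_true rfl (.inl rfl)
  · refine iff_of_false (OnePoint.infty_ne_coe _) ?_
    rintro (h | h) <;> cases h
  · refine iff_of_false (OnePoint.coe_ne_infty _) ?_
    rintro (h | h) <;> cases h
  · exact OnePoint.coe_injective.eq_iff.trans Affine.Point.X_eq_iff

theorem xCoord_galPoint (E : WeierstrassCurve K) (σ : AlgebraicClosure K ≃ₐ[K] AlgebraicClosure K)
    (P : GeomPoint E) : xCoord E (galPoint E σ P) = (xCoord E P).map σ := by
  rcases P with _ | ⟨x, y, h⟩ <;> rfl

section EvenDegreeTwo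

variable [CharZero K] {E : WeierstrassCurve K} {f : E.toAffine.FunctionField}

theorem exists_toP1_eq_smul (hf : IsEven E f) (hd : degree E f = 2) :
    ∃ g : Matrix.GeneralLinearGroup (Fin 2) K, ∀ P, toP1 E f P =
      g.map (algebraMap K (AlgebraicClosure K)) • xCoord E P := by
  obtain ⟨a, b, c, d, hdet, h⟩ := exists_moebius hf hd
  exact ⟨_, toP1_eq_smul_xCoord hdet h⟩

theorem toP1_eq_iff (hf : IsEven E f) (hd : degree E f = 2) {P Q : GeomPoint E} :
    toP1 E f P = toP1 E f Q ↔ P = Q ∨ P = -Q := by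
  obtain ⟨g, hg⟩ := exists_toP1_eq_smul hf hd
  rw [hg, hg, (MulAction.injective _).eq_iff, xCoord_eq_iff]

/-- The matrix relating `f` to `x` has entries in `K`, which `σ` fixes. -/
theorem toP1_galPoint (hf : IsEven E f) (hd : degree E f = 2)
    (σ : AlgebraicClosure K ≃ₐ[K] AlgebraicClosure K) (P : GeomPoint E) :
    toP1 E f (galPoint E σ P) = (toP1 E f P).map σ := by
  obtain ⟨g, hg⟩ := exists_toP1_eq_smul hf hd
  rw [hg, hg, xCoord_galPoint]
  refine Eq.trans ?_ (OnePoint.map_smul (σ : AlgebraicClosure K →+* AlgebraicClosure K) _ _).symm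
  congr 1
  ext i j
  exact (σ.commutes _).symm

end EvenDegreeTwo

/-! ### Galois action on torsion points -/

section Galois

variable {E : WeierstrassCurve K}

theorem galPoint_one (P : GeomPoint E) : galPoint E 1 P = P := by
  rcases P with _ | _ <;> rfl

theorem galPoint_mul (σ τ : AlgebraicClosure K ≃ₐ[K] AlgebraicClosure K) (P : GeomPoint E) :
    galPoint E (σ * τ) P = galPoint E σ (galPoint E τ P) := by
  rcases P with _ | _ <;> rfl

theorem galPoint_inv_galPoint (σ : AlgebraicClosure K ≃ₐ[K] AlgebraicClosure K) (P : GeomPoint E) :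
    galPoint E σ⁻¹ (galPoint E σ P) = P := by
  rw [← galPoint_mul, inv_mul_cancel, galPoint_one]

theorem galPoint_galPoint_inv (σ : AlgebraicClosure K ≃ₐ[K] AlgebraicClosure K) (P : GeomPoint E) :
    galPoint E σ (galPoint E σ⁻¹ P) = P := by
  rw [← galPoint_mul, mul_inv_cancel, galPoint_one]

theorem addOrderOf_galPoint (σ : AlgebraicClosure K ≃ₐ[K] AlgebraicClosure K) (P : GeomPoint E) :
    addOrderOf (galPoint E σ P) = addOrderOf P :=
  addOrderOf_injective (galPoint E σ)
    (Function.LeftInverse.injective (galPoint_inv_galPoint σ)) P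

theorem TorsionBasis.galTorsion_basis (B : TorsionBasis E) (n : ℕ+)
    (σ : AlgebraicClosure K ≃ₐ[K] AlgebraicClosure K) (j : Fin 2) :
    galTorsion E n σ (B.basis n j) =
      B.matrixMod n σ 0 j • B.basis n 0 + B.matrixMod n σ 1 j • B.basis n 1 := by
  rw [B.matrixMod_apply, B.matrixMod_apply, ← Fin.sum_univ_two fun i =>
    (B.basis n).repr (galTorsion E n σ (B.basis n j)) i • B.basis n i, Module.Basis.sum_repr]

theorem TorsionBasis.galPoint_eq_of_matrixMod (B : TorsionBasis E) (n : ℕ+)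
    (σ : AlgebraicClosure K ≃ₐ[K] AlgebraicClosure K) (j : Fin 2) {a b : ℤ}
    (ha : (a : ZMod n) = B.matrixMod n σ 0 j) (hb : (b : ZMod n) = B.matrixMod n σ 1 j) :
    galPoint E σ (B.basis n j) =
      a • (B.basis n 0 : GeomPoint E) + b • (B.basis n 1 : GeomPoint E) := by
  have h := B.galTorsion_basis n σ j
  rw [← ha, ← hb, Int.cast_smul_eq_zsmul, Int.cast_smul_eq_zsmul] at h
  exact congrArg Subtype.val h

/-- Integral matrices are all that is needed from `SL(2, Ẑ)`; they spare the lifting of matrices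
from `ℤ/n`. -/
theorem TorsionBasis.exists_matrixMod_eq {B : TorsionBasis E}
    (hB : (cyc K).fixingSubgroup.map B.rho =
      (Matrix.SpecialLinearGroup.toGL (n := Fin 2) (R := ZHat)).range)
    (γ : Matrix.SpecialLinearGroup (Fin 2) ℤ) :
    ∃ σ ∈ (cyc K).fixingSubgroup, ∀ (n : ℕ+) (i j : Fin 2),
      ((γ i j : ℤ) : ZMod n) = B.matrixMod n σ i j := by
  have h : Matrix.SpecialLinearGroup.toGL (γ.map (Int.castRingHom ZHat)) ∈
      (cyc K).fixingSubgroup.map B.rho := hB ▸ ⟨_, rfl⟩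
  obtain ⟨σ, hσ, h⟩ := h
  refine ⟨σ, hσ, fun n i j => ?_⟩
  have hij := congrArg (fun M : Matrix.GeneralLinearGroup (Fin 2) ZHat =>
    ((M : Matrix (Fin 2) (Fin 2) ZHat) i j : ∀ n : ℕ+, ZMod n) n) h
  refine Eq.trans ?_ hij.symm
  change _ = ((Int.castRingHom ZHat (γ i j) : ZHat) : ∀ n : ℕ+, ZMod n) n
  exact (map_intCast ((Pi.evalRingHom (fun n : ℕ+ => ZMod n) n).comp ZHat.subtype) (γ i j)).symm

theorem TorsionBasis.det_matrixMod {B : TorsionBasis E}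
    (hB : (cyc K).fixingSubgroup.map B.rho =
      (Matrix.SpecialLinearGroup.toGL (n := Fin 2) (R := ZHat)).range)
    {σ : AlgebraicClosure K ≃ₐ[K] AlgebraicClosure K} (hσ : σ ∈ (cyc K).fixingSubgroup) (n : ℕ+) :
    B.matrixMod n σ 0 0 * B.matrixMod n σ 1 1 - B.matrixMod n σ 0 1 * B.matrixMod n σ 1 0 = 1 := by
  have h : B.rho σ ∈ (Matrix.SpecialLinearGroup.toGL (n := Fin 2) (R := ZHat)).range :=
    hB ▸ ⟨σ, hσ, rfl⟩
  obtain ⟨s, hs⟩ := h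
  have hij : ∀ i j, ((s i j : ZHat) : ∀ n : ℕ+, ZMod n) n = B.matrixMod n σ i j := fun i j =>
    congrArg (fun M : Matrix.GeneralLinearGroup (Fin 2) ZHat =>
      ((M : Matrix (Fin 2) (Fin 2) ZHat) i j : ∀ n : ℕ+, ZMod n) n) hs
  have hdet := s.det_coe
  rw [Matrix.det_fin_two] at hdet
  rw [← hij, ← hij, ← hij, ← hij]
  exact congrArg (fun z : ZHat => (z : ∀ n : ℕ+, ZMod n) n) hdet

end Galois

/-! ### Frames of the torsion subgroups -/

/-- `P, Q` is a basis of `E[n]` in which the group `H` of automorphisms acts on `E[n]` through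
the whole of `SL(2, ℤ/n)`. -/
structure IsFrame (E : WeierstrassCurve K)
    (H : Subgroup (AlgebraicClosure K ≃ₐ[K] AlgebraicClosure K)) (n : ℕ) (P Q : GeomPoint E) :
    Prop where
  eq_zero_iff : ∀ a b : ℤ, a • P + b • Q = 0 ↔ (n : ℤ) ∣ a ∧ (n : ℤ) ∣ b
  exists_eq : ∀ R : GeomPoint E, n • R = 0 → ∃ a b : ℤ, R = a • P + b • Q
  exists_galPoint : ∀ γ : Matrix.SpecialLinearGroup (Fin 2) ℤ, ∃ σ ∈ H,
    galPoint E σ P = γ 0 0 • P + γ 1 0 • Q ∧ galPoint E σ Q = γ 0 1 • P + γ 1 1 • Q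
  galPoint_eq : ∀ σ ∈ H, ∃ a b c d : ℤ, galPoint E σ P = a • P + c • Q ∧
    galPoint E σ Q = b • P + d • Q ∧ (n : ℤ) ∣ a * d - b * c - 1

theorem TorsionBasis.isFrame {E : WeierstrassCurve K} {B : TorsionBasis E}
    (hB : (cyc K).fixingSubgroup.map B.rho =
      (Matrix.SpecialLinearGroup.toGL (n := Fin 2) (R := ZHat)).range) (n : ℕ+) :
    IsFrame E (cyc K).fixingSubgroup n (B.basis n 0) (B.basis n 1) where
  eq_zero_iff a b := by
    rw [← ZMod.intCast_zmod_eq_zero_iff_dvd, ← ZMod.intCast_zmod_eq_zero_iff_dvd]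
    have h1 : a • (B.basis n 0 : GeomPoint E) + b • (B.basis n 1 : GeomPoint E) =
        (((a : ZMod n) • B.basis n 0 + (b : ZMod n) • B.basis n 1 : nTorsion E n) :
          GeomPoint E) := by
      rw [Int.cast_smul_eq_zsmul, Int.cast_smul_eq_zsmul]
      rfl
    rw [h1]
    constructor
    · intro h
      have h2 : (a : ZMod n) • B.basis n 0 + (b : ZMod n) • B.basis n 1 = 0 := Subtype.ext h
      have h3 := Fintype.linearIndependent_iff.mp (B.basis n).linearIndependent
        ![(a : ZMod n), (b : ZMod n)] (by rw [Fin.sum_univ_two]; exact h2)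
      exact ⟨h3 0, h3 1⟩
    · rintro ⟨ha, hb⟩
      rw [ha, hb, zero_smul, zero_smul, add_zero]
      rfl
  exists_eq R hR := by
    let R' : nTorsion E n := ⟨R, AddSubgroup.torsionBy.nsmul_iff.mpr hR⟩
    obtain ⟨a, ha⟩ := ZMod.intCast_surjective ((B.basis n).repr R' 0)
    obtain ⟨b, hb⟩ := ZMod.intCast_surjective ((B.basis n).repr R' 1)
    refine ⟨a, b, ?_⟩
    have h := (B.basis n).sum_repr R'
    rw [Fin.sum_univ_two, ← ha, ← hb, Int.cast_smul_eq_zsmul, Int.cast_smul_eq_zsmul] at h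
    exact (congrArg Subtype.val h).symm
  exists_galPoint γ := by
    obtain ⟨σ, hσ, h⟩ := B.exists_matrixMod_eq hB γ
    exact ⟨σ, hσ, B.galPoint_eq_of_matrixMod n σ 0 (h n 0 0) (h n 1 0),
      B.galPoint_eq_of_matrixMod n σ 1 (h n 0 1) (h n 1 1)⟩
  galPoint_eq σ hσ := by
    obtain ⟨a, ha⟩ := ZMod.intCast_surjective (B.matrixMod n σ 0 0)
    obtain ⟨b, hb⟩ := ZMod.intCast_surjective (B.matrixMod n σ 0 1)
    obtain ⟨c, hc⟩ := ZMod.intCast_surjective (B.matrixMod n σ 1 0)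
    obtain ⟨d, hd⟩ := ZMod.intCast_surjective (B.matrixMod n σ 1 1)
    refine ⟨a, b, c, d, B.galPoint_eq_of_matrixMod n σ 0 ha hc,
      B.galPoint_eq_of_matrixMod n σ 1 hb hd, ?_⟩
    have hdet := B.det_matrixMod hB hσ n
    rw [← ha, ← hb, ← hc, ← hd] at hdet
    rw [← ZMod.intCast_zmod_eq_zero_iff_dvd]
    push_cast
    rw [hdet, sub_self]

/-- Take for `t` the product of the primes dividing `a` but not `b`. A prime factor of `a` then
divides exactly one of `b` and `tn`. This turns a primitive vector mod `n` into a column of a matrix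
in `SL(2, ℤ)`. -/
theorem exists_isCoprime_add_mul {a b n : ℤ} (ha : a ≠ 0)
    (h : ∀ p : ℕ, p.Prime → ¬ ((p : ℤ) ∣ a ∧ (p : ℤ) ∣ b ∧ (p : ℤ) ∣ n)) :
    ∃ t : ℤ, IsCoprime a (b + t * n) := by
  let s : Finset ℕ := a.natAbs.primeFactors.filter fun p => ¬ (p : ℤ) ∣ b
  refine ⟨∏ p ∈ s, (p : ℤ), ?_⟩
  rw [Int.isCoprime_iff_gcd_eq_one]
  by_contra hne
  obtain ⟨p, hp, hdvd⟩ := Nat.exists_prime_and_dvd hne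
  have hpa : (p : ℤ) ∣ a := (Int.natCast_dvd_natCast.mpr hdvd).trans (Int.gcd_dvd_left ..)
  have hpb : (p : ℤ) ∣ b + (∏ p ∈ s, (p : ℤ)) * n :=
    (Int.natCast_dvd_natCast.mpr hdvd).trans (Int.gcd_dvd_right ..)
  have hpp : Prime (p : ℤ) := Nat.prime_iff_prime_int.mp hp
  by_cases hb : (p : ℤ) ∣ b
  · rcases hpp.dvd_or_dvd ((dvd_add_right hb).mp hpb) with h1 | h1
    · obtain ⟨q, hq, hpq⟩ := hpp.exists_mem_finset_dvd h1
      rw [Finset.mem_filter, Nat.mem_primeFactors] at hq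
      rw [Int.natCast_dvd_natCast, Nat.prime_dvd_prime_iff_eq hp hq.1.1] at hpq
      exact hq.2 (hpq ▸ hb)
    · exact h p hp ⟨hpa, hb, h1⟩
  · refine hb ((dvd_add_left (Dvd.dvd.mul_right (Finset.dvd_prod_of_mem _ ?_) n)).mp hpb)
    rw [Finset.mem_filter, Nat.mem_primeFactors]
    exact ⟨⟨hp, Int.natCast_dvd.mp hpa, Int.natAbs_ne_zero.mpr ha⟩, hb⟩

/-! ### Transitivity, transvections and stabilisers up to sign -/

namespace IsFrame

variable {E : WeierstrassCurve K} {H : Subgroup (AlgebraicClosure K ≃ₐ[K] AlgebraicClosure K)}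
  {n : ℕ} {P Q : GeomPoint E}

theorem nsmul_left (h : IsFrame E H n P Q) : (n : ℤ) • P = 0 := by
  have := (h.eq_zero_iff n 0).mpr ⟨dvd_rfl, dvd_zero _⟩
  rwa [zero_zsmul, add_zero] at this

theorem nsmul_right (h : IsFrame E H n P Q) : (n : ℤ) • Q = 0 := by
  have := (h.eq_zero_iff 0 n).mpr ⟨dvd_zero _, dvd_rfl⟩
  rwa [zero_zsmul, zero_add] at this

/-- In the image basis, `τστ⁻¹` has the matrix that `σ` has in the old one. -/
theorem map (h : IsFrame E H n P Q) {τ : AlgebraicClosure K ≃ₐ[K] AlgebraicClosure K}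
    (hτ : τ ∈ H) : IsFrame E H n (galPoint E τ P) (galPoint E τ Q) where
  eq_zero_iff a b := by
    rw [← h.eq_zero_iff, ← map_zsmul, ← map_zsmul, ← map_add, map_eq_zero_iff _
      (Function.LeftInverse.injective (galPoint_inv_galPoint τ))]
  exists_eq R hR := by
    obtain ⟨a, b, hab⟩ := h.exists_eq (galPoint E τ⁻¹ R) (by rw [← map_nsmul, hR, map_zero])
    refine ⟨a, b, ?_⟩
    rw [← map_zsmul, ← map_zsmul, ← map_add, ← hab, galPoint_galPoint_inv]
  exists_galPoint γ := by
    obtain ⟨σ, hσ, h1, h2⟩ := h.exists_galPoint γ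
    refine ⟨τ * σ * τ⁻¹, H.mul_mem (H.mul_mem hτ hσ) (H.inv_mem hτ), ?_, ?_⟩
    · rw [galPoint_mul, galPoint_mul, galPoint_inv_galPoint, h1, map_add, map_zsmul, map_zsmul]
    · rw [galPoint_mul, galPoint_mul, galPoint_inv_galPoint, h2, map_add, map_zsmul, map_zsmul]
  galPoint_eq σ hσ := by
    obtain ⟨a, b, c, d, h1, h2, h3⟩ := h.galPoint_eq (τ⁻¹ * σ * τ)
      (H.mul_mem (H.mul_mem (H.inv_mem hτ) hσ) hτ)
    refine ⟨a, b, c, d, ?_, ?_, h3⟩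
    · rw [← map_zsmul, ← map_zsmul, ← map_add, ← h1, galPoint_mul, galPoint_mul,
        galPoint_galPoint_inv]
    · rw [← map_zsmul, ← map_zsmul, ← map_add, ← h2, galPoint_mul, galPoint_mul,
        galPoint_galPoint_inv]

/-- `H` acts transitively on the points of exact order `n`. -/
theorem exists_galPoint_eq (h : IsFrame E H n P Q) (hn : 0 < n) {R : GeomPoint E}
    (hR : addOrderOf R = n) : ∃ τ ∈ H, galPoint E τ P = R := by
  -- The coefficient `a` matters only mod `n`, so `0` may be replaced by `n`.
  obtain ⟨a, b, ha0, rfl⟩ : ∃ a b : ℤ, a ≠ 0 ∧ R = a • P + b • Q := by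
    obtain ⟨a, b, hab⟩ := h.exists_eq R (hR ▸ addOrderOf_nsmul_eq_zero R)
    by_cases ha : a = 0
    · refine ⟨n, b, by exact_mod_cast hn.ne', ?_⟩
      rw [hab, ha, h.nsmul_left, zero_zsmul]
    · exact ⟨a, b, ha, hab⟩
  -- A prime `p` dividing `a`, `b` and `n` would give `(n/p) R = 0`, against the order of `R`.
  obtain ⟨t, ht⟩ := exists_isCoprime_add_mul (n := n) (b := b) ha0 fun p hp ⟨h1, h2, h3⟩ => by
    obtain ⟨m, hm⟩ := Int.natCast_dvd_natCast.mp h3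
    have hm0 : 0 < m := Nat.pos_of_ne_zero fun h0 => hn.ne' (by rw [hm, h0, mul_zero])
    have hlt : m < n := by
      rw [hm]
      exact lt_mul_of_one_lt_left hm0 hp.one_lt
    refine hlt.not_ge (Nat.le_of_dvd hm0 ?_)
    rw [← hR, addOrderOf_dvd_iff_nsmul_eq_zero, ← natCast_zsmul, zsmul_add, ← mul_zsmul, ← mul_zsmul,
      h.eq_zero_iff, hm, Nat.cast_mul, mul_comm (p : ℤ)]
    exact ⟨mul_dvd_mul_left _ h1, mul_dvd_mul_left _ h2⟩
  obtain ⟨γ, h0, h1⟩ := ht.exists_SL2_col 0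
  obtain ⟨τ, hτ, hP, -⟩ := h.exists_galPoint γ
  refine ⟨τ, hτ, ?_⟩
  rw [hP, h0, h1, add_zsmul, mul_zsmul, h.nsmul_right, zsmul_zero, add_zero]

/-- The frame can be chosen to start with a given point of exact order `n`. -/
theorem exists_of_addOrderOf_eq (h : IsFrame E H n P Q) (hn : 0 < n) {R : GeomPoint E}
    (hR : addOrderOf R = n) : ∃ S, IsFrame E H n R S := by
  obtain ⟨τ, hτ, rfl⟩ := h.exists_galPoint_eq hn hR
  exact ⟨_, h.map hτ⟩

/-- The powers of this `σ` detect the order of `P`: `σ ^ k` fixes `Q` only if `k • P = 0`. -/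
theorem exists_transvection (h : IsFrame E H n P Q) :
    ∃ σ ∈ H, galPoint E σ P = P ∧ ∀ k : ℕ, galPoint E (σ ^ k) Q = Q + (k : ℤ) • P := by
  obtain ⟨σ, hσ, h1, h2⟩ := h.exists_galPoint ⟨!![1, 1; 0, 1], by simp [Matrix.det_fin_two]⟩
  have hP : galPoint E σ P = P := by simpa using h1
  have hQ : galPoint E σ Q = P + Q := by simpa using h2
  refine ⟨σ, hσ, hP, fun k => ?_⟩
  induction k with
  | zero => simp [galPoint_one]
  | succ k ih =>
    rw [pow_succ', galPoint_mul, ih, map_add, map_zsmul, hP, hQ]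
    push_cast
    rw [add_zsmul, one_zsmul]
    abel

theorem exists_galPoint_eq_right (h : IsFrame E H n P Q) : ∃ σ ∈ H, galPoint E σ P = Q := by
  obtain ⟨σ, hσ, h1, -⟩ := h.exists_galPoint ⟨!![0, -1; 1, 0], by simp [Matrix.det_fin_two]⟩
  exact ⟨σ, hσ, by simpa using h1⟩

/-- If `σ` fixes `P` up to sign, then `σ ^ n` acts on `E[n]` as a sign. -/
theorem galPoint_pow_eq_or (h : IsFrame E H n P Q)
    {σ : AlgebraicClosure K ≃ₐ[K] AlgebraicClosure K} (hσ : σ ∈ H)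
    (hP : galPoint E σ P = P ∨ galPoint E σ P = -P) {R : GeomPoint E} (hR : n • R = 0) :
    galPoint E (σ ^ n) R = R ∨ galPoint E (σ ^ n) R = -R := by
  obtain ⟨e, he, hP⟩ : ∃ e : ℤ, (e = 1 ∨ e = -1) ∧ galPoint E σ P = e • P := by
    rcases hP with hP | hP
    · exact ⟨1, .inl rfl, by rw [hP, one_zsmul]⟩
    · exact ⟨-1, .inr rfl, by rw [hP, neg_zsmul, one_zsmul]⟩
  have he2 : e * e = 1 := by rcases he with rfl | rfl <;> rfl
  obtain ⟨a, b, c, d, h1, h2, h3⟩ := h.galPoint_eq σ hσ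
  have hac := (h.eq_zero_iff (a - e) c).mp (by rw [sub_zsmul, ← hP, h1]; abel)
  -- Modulo `n`, `a = e` and `c = 0`, so determinant 1 reads `ed = 1`, that is `d = e`.
  have hde : (n : ℤ) ∣ d - e := by
    have h4 : d - e = e * (a * d - b * c - 1) + e * b * c - e * d * (a - e) := by
      linear_combination -d * he2
    rw [h4]
    exact dvd_sub (dvd_add (h3.mul_left _) (hac.2.mul_left _)) (hac.1.mul_left _)
  have hQ : galPoint E σ Q = b • P + e • Q := by
    have := (h.eq_zero_iff 0 (d - e)).mpr ⟨dvd_zero _, hde⟩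
    rw [zero_zsmul, zero_add, sub_zsmul, ← sub_eq_add_neg, sub_eq_zero] at this
    rw [h2, this]
  have hPk : ∀ k : ℕ, galPoint E (σ ^ k) P = e ^ k • P := fun k => by
    induction k with
    | zero => simp [galPoint_one]
    | succ k ih => rw [pow_succ', galPoint_mul, ih, map_zsmul, hP, ← mul_zsmul, pow_succ]
  -- The coefficient of `P` is `k e^(k-1) b`, with `e^(k-1)` written as `e^k * e` because `e² = 1`.
  -- At `k = n` it kills `P`.
  have hQk : ∀ k : ℕ, galPoint E (σ ^ k) Q = e ^ k • Q + (e ^ k * e * b * k) • P := fun k => by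
    induction k with
    | zero => simp [galPoint_one]
    | succ k ih =>
      rw [pow_succ', galPoint_mul, ih, map_add, map_zsmul, map_zsmul, hP, hQ, zsmul_add, smul_smul,
        smul_smul, smul_smul, add_comm (_ • P), add_assoc, ← add_zsmul]
      congr 2
      · ring
      · push_cast
        linear_combination -(e ^ k * b) * he2
  obtain ⟨u, v, rfl⟩ := h.exists_eq R hR
  have key : galPoint E (σ ^ n) (u • P + v • Q) = e ^ n • (u • P + v • Q) := by
    rw [map_add, map_zsmul, map_zsmul, hPk, hQk, mul_zsmul _ _ (n : ℤ), h.nsmul_left, zsmul_zero,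
      add_zero, zsmul_add, zsmul_comm P, zsmul_comm Q]
  rw [key]
  have hen : e ^ n = 1 ∨ e ^ n = -1 := by
    rcases he with rfl | rfl
    · exact .inl (one_pow n)
    · exact neg_one_pow_eq_or ℤ n
  rcases hen with hen | hen <;> rw [hen]
  · exact .inl (one_zsmul _)
  · exact .inr (by rw [neg_zsmul, one_zsmul])

end IsFrame

/-! ### Common values of the two functions at torsion points -/

section Intersection

variable {E₁ E₂ : WeierstrassCurve K} {π₁ : E₁.toAffine.FunctionField}
  {π₂ : E₂.toAffine.FunctionField} {H : Subgroup (AlgebraicClosure K ≃ₐ[K] AlgebraicClosure K)}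
  {m n : ℕ} {P₁ Q₁ : GeomPoint E₁} {P₂ Q₂ : GeomPoint E₂}

/-- A transvection on `E₁[m]` fixing `P₁` is forced to act on `E₂[n]` with `n`-th power `±1`. Moving
the common value by `τ` to `Q₁` carries this back to `E₁`. -/
theorem IsFrame.dvd_of_toP1_eq [CharZero K] (heven₁ : IsEven E₁ π₁) (heven₂ : IsEven E₂ π₂)
    (hdeg₁ : degree E₁ π₁ = 2) (hdeg₂ : degree E₂ π₂ = 2)
    (h₁ : IsFrame E₁ H m P₁ Q₁) (h₂ : IsFrame E₂ H n P₂ Q₂)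
    (h : toP1 E₁ π₁ P₁ = toP1 E₂ π₂ P₂) : m ∣ n := by
  have transfer : ∀ (R : GeomPoint E₁) (S : GeomPoint E₂), toP1 E₁ π₁ R = toP1 E₂ π₂ S → ∀ σ,
      toP1 E₁ π₁ (galPoint E₁ σ R) = toP1 E₂ π₂ (galPoint E₂ σ S) := fun R S hRS σ => by
    rw [toP1_galPoint heven₁ hdeg₁, toP1_galPoint heven₂ hdeg₂, hRS]
  obtain ⟨σ, hσ, hP, hQ⟩ := h₁.exists_transvection
  have hP₂ : galPoint E₂ σ P₂ = P₂ ∨ galPoint E₂ σ P₂ = -P₂ := by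
    rw [← toP1_eq_iff heven₂ hdeg₂, ← transfer P₁ P₂ h, hP, h]
  obtain ⟨τ, hτ, hτP⟩ := h₁.exists_galPoint_eq_right
  have hQR := transfer P₁ P₂ h τ
  rw [hτP] at hQR
  have hR : n • galPoint E₂ τ P₂ = 0 := by
    rw [← map_nsmul, ← natCast_zsmul, h₂.nsmul_left, map_zero]
  have hfix := (toP1_eq_iff heven₂ hdeg₂).mpr (h₂.galPoint_pow_eq_or hσ hP₂ hR)
  rw [← transfer _ _ hQR, ← hQR, toP1_eq_iff heven₁ hdeg₁, hQ] at hfix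
  rw [← Int.natCast_dvd_natCast]
  -- The sign `+` gives `nP₁ = 0`, the sign `-` gives `nP₁ + 2Q₁ = 0`; independence yields `m ∣ n`
  -- in both cases.
  rcases hfix with hfix | hfix
  · refine ((h₁.eq_zero_iff n 0).mp ?_).1
    rw [zero_zsmul, add_zero]
    exact add_eq_left.mp hfix
  · refine ((h₁.eq_zero_iff n 2).mp ?_).1
    rw [two_zsmul, ← add_assoc, add_comm (_ • P₁) Q₁, hfix, neg_add_cancel]

/-- Every point of exact order `n` on `E₁` is some `τP₁`, and its value is that of `τP₂`, again of
order `n`. -/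
theorem IsFrame.image_exactTorsion_subset [CharZero K]
    (heven₁ : IsEven E₁ π₁) (heven₂ : IsEven E₂ π₂)
    (hdeg₁ : degree E₁ π₁ = 2) (hdeg₂ : degree E₂ π₂ = 2) (hn : 0 < n)
    (h₁ : IsFrame E₁ H n P₁ Q₁) (hP₂ : addOrderOf P₂ = n)
    (h : toP1 E₁ π₁ P₁ = toP1 E₂ π₂ P₂) :
    toP1 E₁ π₁ '' exactTorsion E₁ n ⊆ toP1 E₂ π₂ '' exactTorsion E₂ n := by
  rintro _ ⟨R, hR, rfl⟩
  obtain ⟨τ, -, rfl⟩ := h₁.exists_galPoint_eq hn hR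
  refine ⟨galPoint E₂ τ P₂, (addOrderOf_galPoint τ P₂).trans hP₂, ?_⟩
  rw [toP1_galPoint heven₁ hdeg₁, toP1_galPoint heven₂ hdeg₂, h]

end Intersection

/-- The only common value of `π₁` and `π₂` at torsion points is their value at the origins. -/
theorem ncard_inter_eq_one {K : Type*} [Field K] [CharZero K] {E₁ E₂ : WeierstrassCurve K}
    {π₁ : E₁.toAffine.FunctionField} {π₂ : E₂.toAffine.FunctionField}
    (heven₁ : IsEven E₁ π₁) (heven₂ : IsEven E₂ π₂)
    (hdeg₁ : degree E₁ π₁ = 2) (hdeg₂ : degree E₂ π₂ = 2)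
    (hO : toP1 E₁ π₁ 0 = toP1 E₂ π₂ 0)
    (hne : ∀ n : ℕ, 1 < n →
      toP1 E₁ π₁ '' exactTorsion E₁ n ≠ toP1 E₂ π₂ '' exactTorsion E₂ n)
    (hSL₁ : AdelicImageIsSL E₁) (hSL₂ : AdelicImageIsSL E₂) :
    (toP1 E₁ π₁ '' torsionPoints E₁ ∩ toP1 E₂ π₂ '' torsionPoints E₂).ncard = 1 := by
  obtain ⟨B₁, hB₁⟩ := hSL₁
  obtain ⟨B₂, hB₂⟩ := hSL₂
  rw [Set.ncard_eq_one]
  refine ⟨toP1 E₁ π₁ 0, Set.eq_singleton_iff_unique_mem.mpr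
    ⟨⟨⟨0, IsOfFinAddOrder.zero, rfl⟩, ⟨0, IsOfFinAddOrder.zero, hO.symm⟩⟩, ?_⟩⟩
  rintro _ ⟨⟨P₁, hP₁, rfl⟩, ⟨P₂, hP₂, h⟩⟩
  have hpos₁ : 0 < addOrderOf P₁ := IsOfFinAddOrder.addOrderOf_pos hP₁
  have hpos₂ : 0 < addOrderOf P₂ := IsOfFinAddOrder.addOrderOf_pos hP₂
  obtain ⟨Q₁, hf₁⟩ := (B₁.isFrame hB₁ ⟨_, hpos₁⟩).exists_of_addOrderOf_eq hpos₁ (R := P₁) rfl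
  obtain ⟨Q₂, hf₂⟩ := (B₂.isFrame hB₂ ⟨_, hpos₂⟩).exists_of_addOrderOf_eq hpos₂ (R := P₂) rfl
  have hord : addOrderOf P₁ = addOrderOf P₂ := Nat.dvd_antisymm
    (hf₁.dvd_of_toP1_eq heven₁ heven₂ hdeg₁ hdeg₂ hf₂ h.symm)
    (hf₂.dvd_of_toP1_eq heven₂ heven₁ hdeg₂ hdeg₁ hf₁ h)
  have hone : addOrderOf P₁ = 1 := by
    by_contra hne1
    refine hne (addOrderOf P₁) (by omega) (Set.Subset.antisymm ?_ ?_)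
    · exact hf₁.image_exactTorsion_subset heven₁ heven₂ hdeg₁ hdeg₂ hpos₁ hord.symm h.symm
    · rw [hord]
      exact hf₂.image_exactTorsion_subset heven₂ heven₁ hdeg₂ hdeg₁ hpos₂ hord h
  rw [AddMonoid.addOrderOf_eq_one_iff.mp hone]

end ProjTorsion

end

theorem theorem12 {K : Type*} [Field K] [NumberField K] (hK : Module.finrank ℚ K ≠ 1)
    (E₁ E₂ : WeierstrassCurve K) [E₁.IsElliptic] [E₂.IsElliptic]
    (π₁ : E₁.toAffine.FunctionField) (π₂ : E₂.toAffine.FunctionField)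
    (heven₁ : ProjTorsion.IsEven E₁ π₁) (heven₂ : ProjTorsion.IsEven E₂ π₂)
    (hdeg₁ : ProjTorsion.degree E₁ π₁ = 2) (hdeg₂ : ProjTorsion.degree E₂ π₂ = 2)
    (hO : ProjTorsion.toP1 E₁ π₁ 0 = ProjTorsion.toP1 E₂ π₂ 0)
    (hne : ∀ n : ℕ, 1 < n →
      ProjTorsion.toP1 E₁ π₁ '' ProjTorsion.exactTorsion E₁ n ≠
        ProjTorsion.toP1 E₂ π₂ '' ProjTorsion.exactTorsion E₂ n)
    (hSL₁ : ProjTorsion.AdelicImageIsSL E₁) (hSL₂ : ProjTorsion.AdelicImageIsSL E₂) :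
    (ProjTorsion.toP1 E₁ π₁ '' ProjTorsion.torsionPoints E₁ ∩
      ProjTorsion.toP1 E₂ π₂ '' ProjTorsion.torsionPoints E₂).ncard = 1 :=
  ProjTorsion.ncard_inter_eq_one heven₁ heven₂ hdeg₁ hdeg₂ hO hne hSL₁ hSL₂
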